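/- Let $n\ge 0$ and $A=\{1,\dots,n\}$. Let $f:2^A\to[0,1]$ be monotone ($S\subseteq S'$ implies $f(S)\le f(S')$) with $f(\emptyset)=0$, and let $c:A\to\mathbb{R}_{>0}$, with $c(S)=\sum_{a\in S}c(a)$ for $S\subseteq A$. Suppose that $f$ is gross substitutes: for all price vectors $p,q\in\mathbb{R}_{\ge 0}^n$ with $p\le q$ coordinatewise and every $S$ that maximizes $f(S')-\sum_{i\in S'}p_i$ over $S'\subseteq A$, there is a $T$ that maximizes $f(T')-\sum_{i\in T'}q_i$ over $T'\subseteq A$ and satisfies $T\supseteq\{i\in S: q_i=p_i\}$. For $\alpha\ge 0$ let $\mathcal{D}_{f,c}(\alpha)$ be the collection of all $S\subseteq A$ that maximize $\alpha f(S)-c(S)$, and let $V_{f,c}(\alpha)=\max_{S\in\mathcal{D}_{f,c}(\alpha)}f(S)$. Call $\alpha\in(0,1]$ critical if $V_{f,c}(\alpha)\ne V_{f,c}(\alpha-\varepsilon)$ for every $\varepsilon\in(0,\alpha]$. Then the set of critical values is finite and has at most $\dfrac{n(n+1)}{2}$ elements. -/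

import Mathlib

namespace CombinatorialContracts

/-- `f` is a success probability function on the set of actions `Fin n`. -/
structure IsSuccessProbability {n : ℕ} (f : Finset (Fin n) → ℝ) : Prop where
  nonneg : ∀ S, 0 ≤ f S
  le_one : ∀ S, f S ≤ 1
  empty : f ∅ = 0
  mono : ∀ S T, S ⊆ T → f S ≤ f T

/-- The collection of sets demanded at the item prices `p`. -/
def priceDemand {n : ℕ} (f : Finset (Fin n) → ℝ) (p : Fin n → ℝ) : Set (Finset (Fin n)) :=
  {S | ∀ S', f S' - ∑ i ∈ S', p i ≤ f S - ∑ i ∈ S, p i}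

/-- The gross substitutes property: if some prices are raised, then for every demanded set `S`
there is a set demanded at the new prices that retains all elements of `S` whose price did
not change. -/
def IsGrossSubstitutes {n : ℕ} (f : Finset (Fin n) → ℝ) : Prop :=
  ∀ p q : Fin n → ℝ, (∀ i, 0 ≤ p i) → (∀ i, 0 ≤ q i) → (∀ i, p i ≤ q i) →
    ∀ S ∈ priceDemand f p, ∃ T ∈ priceDemand f q, ∀ i ∈ S, q i = p i → i ∈ T

/-- The agent's expected utility from the set `S` of actions under the contract `α`. -/
def agentUtility {n : ℕ} (f : Finset (Fin n) → ℝ) (c : Fin n → ℝ) (α : ℝ)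
    (S : Finset (Fin n)) : ℝ :=
  α * f S - ∑ a ∈ S, c a

/-- The collection of sets of actions that maximize the agent's utility under the
contract `α`. -/
def demand {n : ℕ} (f : Finset (Fin n) → ℝ) (c : Fin n → ℝ) (α : ℝ) : Set (Finset (Fin n)) :=
  {S | ∀ S', agentUtility f c α S' ≤ agentUtility f c α S}

/-- The agent's best responses: among the demanded sets, those with the highest success
probability. For `α < 1` these are the demanded sets that are best for the principal, whose
utility is `(1 - α) * f S`, see `mem_bestResponses_iff`; at `α = 1` the principal's utility
does not distinguish sets and ties are still broken in favour of the higher `f S`. -/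
def bestResponses {n : ℕ} (f : Finset (Fin n) → ℝ) (c : Fin n → ℝ) (α : ℝ) :
    Set (Finset (Fin n)) :=
  {S | S ∈ demand f c α ∧ ∀ S' ∈ demand f c α, f S' ≤ f S}

theorem mem_bestResponses_iff {n : ℕ} (f : Finset (Fin n) → ℝ) (c : Fin n → ℝ) {α : ℝ}
    (hα : α < 1) (S : Finset (Fin n)) :
    S ∈ bestResponses f c α ↔
      S ∈ demand f c α ∧ ∀ S' ∈ demand f c α, (1 - α) * f S' ≤ (1 - α) * f S := by
  have h : (0 : ℝ) < 1 - α := sub_pos.mpr hα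
  simp only [bestResponses, Set.mem_ofPred_eq, mul_le_mul_iff_right₀ h]

theorem bestResponses_nonempty {n : ℕ} (f : Finset (Fin n) → ℝ) (c : Fin n → ℝ) (α : ℝ) :
    (bestResponses f c α).Nonempty := by
  obtain ⟨S₀, h₀⟩ := Finite.exists_max (agentUtility f c α)
  obtain ⟨S, hS, hmax⟩ :=
    Set.exists_max_image (demand f c α) f (Set.toFinite _) ⟨S₀, h₀⟩
  exact ⟨S, hS, hmax⟩

/-- The common value `V(α)` of `f S` over all best responses `S` to the contract `α`. -/
noncomputable def responseValue {n : ℕ} (f : Finset (Fin n) → ℝ) (c : Fin n → ℝ) (α : ℝ) : ℝ :=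
  f (bestResponses_nonempty f c α).some

theorem responseValue_eq {n : ℕ} {f : Finset (Fin n) → ℝ} {c : Fin n → ℝ} {α : ℝ}
    {S : Finset (Fin n)} (hS : S ∈ bestResponses f c α) : responseValue f c α = f S :=
  le_antisymm (hS.2 _ (bestResponses_nonempty f c α).some_mem.1)
    ((bestResponses_nonempty f c α).some_mem.2 _ hS.1)

/-- The set of critical values of `α`: those contracts in `(0, 1]` whose value differs from that
of every smaller contract. -/
def criticalSet {n : ℕ} (f : Finset (Fin n) → ℝ) (c : Fin n → ℝ) : Set ℝ :=
  {α | α ∈ Set.Ioc (0 : ℝ) 1 ∧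
    ∀ ε : ℝ, 0 < ε → ε ≤ α → responseValue f c α ≠ responseValue f c (α - ε)}

end CombinatorialContracts

/-!
The potential of a set of actions is the sum of the ranks of its elements, where the actions are
ranked `1, …, n` in the order of their costs. It lies between `0` and `n (n + 1) / 2`, so it is
enough to see that the largest potential of a set demanded at `α` grows strictly with `α` along
the critical values, and is positive at each of them.

Dividing the agent's utility by `α` turns the contract `α` into the price vector `c / α`. Gross
substitutes implies the single improvement property at positive prices
(`IsGrossSubstitutes.exists_single_improvement`): a set that is not demanded can be improved by
adding at most one item and removing at most one. Apply this at a contract slightly above `γ` to a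
set `S` that is demanded at `γ` without being a best response there. The improvement is again
demanded at `γ`, and it has a higher success probability, hence a higher cost. Since at most one
action was exchanged for another, the higher cost forces a higher potential
(`exists_mem_demand_potential_lt`). So the sets of largest potential among the demanded ones are
best responses, and all demanded sets that are not best responses have a smaller potential.

As the contract grows from `α` to `β`, a best response `S` at `α` remains one until it
reaches the smallest slope `(c U - c S) / (f U - f S)` over the sets `U` with `f S < f U`. There
`S` is still demanded but no longer a best response, so the potential jumps up. Iterating gives
`potential_le_maxPotential`. No genericity of the costs is needed, since the potential increases
at each single exchange, however many exchanges happen at one contract.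
-/

namespace CombinatorialContracts

open Finset Filter Topology

variable {n : ℕ} {f : Finset (Fin n) → ℝ} {c : Fin n → ℝ}

/-! ### Gross substitutes and single improvements -/

theorem priceDemand_nonempty (f : Finset (Fin n) → ℝ) (p : Fin n → ℝ) :
    (priceDemand f p).Nonempty :=
  Finite.exists_max fun S => f S - ∑ i ∈ S, p i

/-- An item of price at least `2` exceeds any possible gain in `f`, so it is never demanded. -/
theorem notMem_of_mem_priceDemand (hf : IsSuccessProbability f) {p : Fin n → ℝ}
    (hp : ∀ i, 0 ≤ p i) {S : Finset (Fin n)} (hS : S ∈ priceDemand f p) {i : Fin n}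
    (hi : 2 ≤ p i) : i ∉ S := by
  intro hiS
  have h1 := hS ∅
  have h2 := hf.le_one S
  have h3 : p i ≤ ∑ j ∈ S, p j := Finset.single_le_sum (fun j _ => hp j) hiS
  rw [hf.empty, Finset.sum_empty] at h1
  linarith

/-- Raising the price of an item outside a demanded set `C` keeps that item out of every
demanded set. By gross substitutes it then also stays out of the sets demanded at lower prices of
the other items. -/
theorem IsGrossSubstitutes.notMem_of_le (hgs : IsGrossSubstitutes f) {p q : Fin n → ℝ}
    (hp : ∀ i, 0 ≤ p i) (hq : ∀ i, 0 ≤ q i) {C : Finset (Fin n)} (hC : C ∈ priceDemand f p)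
    {a : Fin n} (ha : a ∉ C) (hqa : p a < q a) (hqp : ∀ i, i ≠ a → q i ≤ p i)
    {E : Finset (Fin n)} (hE : E ∈ priceDemand f q) : a ∉ E := by
  intro haE
  set r : Fin n → ℝ := Function.update p a (q a) with hr
  have hra : r a = q a := by simp [hr]
  have hrne : ∀ i, i ≠ a → r i = p i := fun i hi => by simp [hr, hi]
  have hpr : ∀ i, p i ≤ r i := fun i => by
    by_cases h : i = a
    · subst h; rw [hra]; exact hqa.le
    · rw [hrne i h]
  have hqr : ∀ i, q i ≤ r i := fun i => by
    by_cases h : i = a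
    · subst h; rw [hra]
    · rw [hrne i h]; exact hqp i h
  obtain ⟨T, hT, hTE⟩ := hgs q r hq (fun i => (hp i).trans (hpr i)) hqr E hE
  have haT : a ∈ T := hTE a haE hra
  have h1 := hT C
  have h2 := hC T
  have h3 : ∑ i ∈ C, r i = ∑ i ∈ C, p i :=
    Finset.sum_congr rfl fun i hi => hrne i fun h => ha (h ▸ hi)
  have h4 : ∑ i ∈ T, p i < ∑ i ∈ T, r i :=
    Finset.sum_lt_sum (fun i _ => hpr i) ⟨a, haT, by rw [hra]; exact hqa⟩
  linarith

/-- Prices that favour the items of `A` by `ε` and penalize all other items by `ε`. -/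
def favor (p : Fin n → ℝ) (A : Finset (Fin n)) (ε : ℝ) (i : Fin n) : ℝ :=
  if i ∈ A then p i - ε else p i + ε

theorem exists_favor_notMem_priceDemand {p : Fin n → ℝ} (hp : ∀ i, 0 < p i)
    {A : Finset (Fin n)} (hA : A ∉ priceDemand f p) :
    ∃ ε > 0, (∀ i, ε ≤ p i) ∧ A ∉ priceDemand f (favor p A ε) := by
  have hA' : ∃ T, f A - ∑ i ∈ A, p i < f T - ∑ i ∈ T, p i := by
    by_contra! h
    exact hA h
  obtain ⟨T, hT⟩ := hA'
  have hcont : ∀ S : Finset (Fin n),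
      Tendsto (fun ε => f S - ∑ i ∈ S, favor p A ε i) (𝓝 0) (𝓝 (f S - ∑ i ∈ S, p i)) := by
    intro S
    refine tendsto_const_nhds.sub (tendsto_finsetSum _ fun i _ => ?_)
    unfold favor
    split_ifs
    · simpa using (tendsto_const_nhds (x := p i)).sub (tendsto_id (x := 𝓝 (0 : ℝ)))
    · simpa using (tendsto_const_nhds (x := p i)).add (tendsto_id (x := 𝓝 (0 : ℝ)))
  have h1 : ∀ᶠ ε in 𝓝 (0 : ℝ),
      f A - ∑ i ∈ A, favor p A ε i < f T - ∑ i ∈ T, favor p A ε i :=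
    (hcont A).eventually_lt (hcont T) hT
  have h2 : ∀ᶠ ε in 𝓝 (0 : ℝ), ∀ i, ε ≤ p i :=
    eventually_all.2 fun i => eventually_le_nhds (hp i)
  have h3 : ∀ᶠ ε in 𝓝[>] (0 : ℝ), 0 < ε := self_mem_nhdsWithin
  obtain ⟨ε, hε, hεp, hεT⟩ :=
    (h3.and ((h2.and h1).filter_mono nhdsWithin_le_nhds)).exists
  exact ⟨ε, hε, hεp, fun h => (h T).not_gt hεT⟩

/-- The single improvement property. The prices are perturbed in favour of `A` by so little that
`A` is still not demanded; every weak improvement at the perturbed prices is then a strict one at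
the prices `p`. -/
theorem IsGrossSubstitutes.exists_single_improvement (hf : IsSuccessProbability f)
    (hgs : IsGrossSubstitutes f) {p : Fin n → ℝ} (hp : ∀ i, 0 < p i) {A : Finset (Fin n)}
    (hA : A ∉ priceDemand f p) :
    ∃ U, f A - ∑ i ∈ A, p i < f U - ∑ i ∈ U, p i ∧ #(A \ U) ≤ 1 ∧ #(U \ A) ≤ 1 := by
  obtain ⟨ε, hε, hεp, hA'⟩ := exists_favor_notMem_priceDemand hp hA
  obtain ⟨B, hB⟩ := priceDemand_nonempty f (favor p A ε)
  have hBA : B ≠ A := fun h => hA' (h ▸ hB)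
  have hfav : ∀ i, 0 ≤ favor p A ε i := fun i => by
    unfold favor
    split_ifs
    · linarith [hεp i]
    · linarith [hp i]
  -- `Y` holds at most one item of `B` outside `A`; the other items outside `A` are priced out.
  obtain ⟨Y, hYA, hY1, hYB, hY⟩ : ∃ Y : Finset (Fin n), Disjoint A Y ∧ #Y ≤ 1 ∧ Y ⊆ B ∧
      (Y = ∅ → B ⊆ A) := by
    rcases (B \ A).eq_empty_or_nonempty with h | ⟨b, hb⟩
    · exact ⟨∅, by simp, by simp, by simp, fun _ => Finset.sdiff_eq_empty_iff_subset.1 h⟩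
    · rw [Finset.mem_sdiff] at hb
      exact ⟨{b}, by simp [hb.2], by simp, by simp [hb.1], by simp⟩
  set p₁ : Fin n → ℝ := fun i => if i ∈ A ∪ Y then favor p A ε i else favor p A ε i + 2 with hp₁
  have hp₁in : ∀ i ∈ A ∪ Y, p₁ i = favor p A ε i := fun i hi => if_pos hi
  have hp₁out : ∀ i, i ∉ A ∪ Y → p₁ i = favor p A ε i + 2 := fun i hi => if_neg hi
  have hle : ∀ i, favor p A ε i ≤ p₁ i := fun i => by
    by_cases h : i ∈ A ∪ Y
    · rw [hp₁in i h]
    · rw [hp₁out i h]; linarith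
  have hp₁0 : ∀ i, 0 ≤ p₁ i := fun i => (hfav i).trans (hle i)
  have hp₁A : ∀ i ∈ A, p₁ i = p i - ε := fun i hi => by
    rw [hp₁in i (Finset.mem_union_left _ hi), favor, if_pos hi]
  have hp₁Y : ∀ i ∈ Y, p₁ i = p i + ε := fun i hi => by
    rw [hp₁in i (Finset.mem_union_right _ hi), favor,
      if_neg (Finset.disjoint_right.1 hYA hi)]
  obtain ⟨C, hC, hYC, hCA⟩ : ∃ C ∈ priceDemand f p₁, Y ⊆ C ∧ (Y = ∅ → ¬ A ⊆ C) := by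
    rcases Y.eq_empty_or_nonempty with h | h
    · refine ⟨B, fun S => ?_, hYB, fun _ hAB => hBA ((hY h).antisymm hAB)⟩
      have h1 := hB S
      have h2 : ∑ i ∈ B, p₁ i = ∑ i ∈ B, favor p A ε i :=
        Finset.sum_congr rfl fun i hi => hp₁in i (Finset.mem_union_left _ (hY h hi))
      have h3 : ∑ i ∈ S, favor p A ε i ≤ ∑ i ∈ S, p₁ i := Finset.sum_le_sum fun i _ => hle i
      linarith
    · obtain ⟨C, hC, hBC⟩ := hgs _ p₁ hfav hp₁0 hle B hB
      exact ⟨C, hC, fun i hi => hBC i (hYB hi) (hp₁in i (Finset.mem_union_right _ hi)),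
        fun h' => absurd h' h.ne_empty⟩
  have hCsub : C ⊆ A ∪ Y := fun i hi => by
    by_contra h
    exact notMem_of_mem_priceDemand hf hp₁0 hC (by rw [hp₁out i h]; linarith [hfav i]) hi
  by_cases hAC : A ⊆ C
  · have hCeq : C = A ∪ Y := hCsub.antisymm (Finset.union_subset hAC hYC)
    have hYne : Y.Nonempty := Finset.nonempty_iff_ne_empty.2 fun h => hCA h hAC
    refine ⟨A ∪ Y, ?_, ?_, ?_⟩
    · have h1 := hC A
      rw [hCeq, Finset.sum_union hYA] at h1
      rw [Finset.sum_union hYA]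
      have h2 : ∑ i ∈ Y, p i < ∑ i ∈ Y, p₁ i :=
        Finset.sum_lt_sum_of_nonempty hYne fun i hi => by rw [hp₁Y i hi]; linarith
      linarith
    · simp [Finset.sdiff_eq_empty_iff_subset.2 (Finset.subset_union_left (s₁ := A) (s₂ := Y))]
    · rw [Finset.union_sdiff_left]
      exact (Finset.card_le_card Finset.sdiff_subset).trans hY1
  · obtain ⟨a, haA, haC⟩ := Finset.not_subset.1 hAC
    have haY : a ∉ Y := Finset.disjoint_left.1 hYA haA
    -- All of `A` except `a` becomes free. The price of `a` rises by `ε / 2`, which keeps `a` out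
    -- of the demand and still leaves it below `p a`.
    set q : Fin n → ℝ := fun i => if i = a then p a - ε / 2 else if i ∈ A then 0 else p₁ i with hq
    have hqa : q a = p a - ε / 2 := if_pos rfl
    have hqA : ∀ i ∈ A.erase a, q i = 0 := fun i hi => by
      rw [Finset.mem_erase] at hi
      simp [hq, hi.1, hi.2]
    have hqout : ∀ i, i ∉ A → q i = p₁ i := fun i hi => by
      have : i ≠ a := fun h => hi (h ▸ haA)
      simp [hq, this, hi]
    have hq0 : ∀ i, 0 ≤ q i := fun i => by
      simp only [hq]
      split_ifs
      · linarith [hεp a]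
      · exact le_rfl
      · exact hp₁0 i
    have hqp : ∀ i, i ≠ a → q i ≤ p₁ i := fun i hi => by
      by_cases h : i ∈ A
      · rw [hqA i (Finset.mem_erase.2 ⟨hi, h⟩)]; exact hp₁0 i
      · rw [hqout i h]
    obtain ⟨E, hE⟩ := priceDemand_nonempty f q
    have haE : a ∉ E :=
      hgs.notMem_of_le hp₁0 hq0 hC haC (by rw [hqa, hp₁A a haA]; linarith) hqp hE
    have hEsub : E \ A ⊆ Y := fun i hi => by
      rw [Finset.mem_sdiff] at hi
      by_contra h
      have h' : i ∉ A ∪ Y := by simp [hi.2, h]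
      exact notMem_of_mem_priceDemand hf hq0 hE
        (by rw [hqout i hi.2, hp₁out i h']; linarith [hfav i]) hi.1
    have hdisj : Disjoint (A.erase a) (E \ A) :=
      Finset.disjoint_sdiff.mono_left (Finset.erase_subset a A)
    refine ⟨A.erase a ∪ E \ A, ?_, ?_, ?_⟩
    · have h1 := hE A
      have h2 : f E ≤ f (A.erase a ∪ E \ A) := hf.mono _ _ fun i hi => by
        by_cases h : i ∈ A
        · exact Finset.mem_union_left _ (Finset.mem_erase.2 ⟨fun h' => haE (h' ▸ hi), h⟩)
        · exact Finset.mem_union_right _ (Finset.mem_sdiff.2 ⟨hi, h⟩)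
      have h3 : ∑ i ∈ A, q i = p a - ε / 2 := by
        rw [← Finset.add_sum_erase A q haA, hqa, Finset.sum_eq_zero hqA, add_zero]
      have h4 : ∑ i ∈ E \ A, p i ≤ ∑ i ∈ E, q i := by
        refine le_trans (Finset.sum_le_sum fun i hi => ?_)
          (Finset.sum_le_sum_of_subset_of_nonneg Finset.sdiff_subset fun i _ _ => hq0 i)
        rw [hqout i (Finset.mem_sdiff.1 hi).2, hp₁Y i (hEsub hi)]
        linarith
      rw [Finset.sum_union hdisj, ← Finset.add_sum_erase A p haA]
      linarith
    · refine (Finset.card_le_card (t := {a}) fun i hi => ?_).trans (Finset.card_singleton a).le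
      rw [Finset.mem_sdiff, Finset.mem_union, Finset.mem_erase] at hi
      by_contra h
      exact hi.2 (Or.inl ⟨fun h' => h (by simp [h']), hi.1⟩)
    · refine (Finset.card_le_card fun i hi => ?_).trans hY1
      rw [Finset.mem_sdiff, Finset.mem_union, Finset.mem_erase] at hi
      exact hEsub (hi.1.resolve_left fun h => hi.2 h.2)

/-! ### The rank potential -/

/-- The rank, in `{1, …, n}`, of an action in the order of the costs, ties being broken by
`Tuple.sort`. -/
noncomputable def rank (c : Fin n → ℝ) (a : Fin n) : ℕ := ((Tuple.sort c).symm a : ℕ) + 1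

/-- The sum of the ranks of the actions in `S`. -/
noncomputable def potential (c : Fin n → ℝ) (S : Finset (Fin n)) : ℕ := ∑ a ∈ S, rank c a

theorem rank_lt_rank {a b : Fin n} (h : c a < c b) : rank c a < rank c b := by
  unfold rank
  by_contra! hba
  have h1 : (Tuple.sort c).symm b ≤ (Tuple.sort c).symm a := by
    rw [Fin.le_def]; omega
  have h2 := Tuple.monotone_sort c h1
  simp only [Function.comp_apply, Equiv.apply_symm_apply] at h2
  exact h2.not_gt h

theorem potential_le (c : Fin n → ℝ) (S : Finset (Fin n)) :
    potential c S ≤ n * (n + 1) / 2 := by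
  have h1 : potential c S ≤ ∑ a, rank c a := Finset.sum_le_sum_of_subset (Finset.subset_univ S)
  have h2 : ∑ a, rank c a = ∑ i : Fin n, ((i : ℕ) + 1) :=
    Equiv.sum_comp (Tuple.sort c).symm fun i : Fin n => (i : ℕ) + 1
  have h3 : ∑ i : Fin n, ((i : ℕ) + 1) = n * (n + 1) / 2 := by
    rw [Fin.sum_univ_eq_sum_range (fun i => i + 1) n]
    have h := Finset.sum_range_id (n + 1)
    rwa [Finset.sum_range_succ', add_zero, Nat.add_sub_cancel, mul_comm] at h
  omega

/-- A set obtained by exchanging at most one action costs more only if its potential is larger. -/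
theorem potential_lt_potential (hc : ∀ a, 0 < c a) {S U : Finset (Fin n)}
    (hSU : #(S \ U) ≤ 1) (hUS : #(U \ S) ≤ 1) (h : ∑ a ∈ S, c a < ∑ a ∈ U, c a) :
    potential c S < potential c U := by
  have hS := Finset.sum_inter_add_sum_sdiff S U c
  have hU := Finset.sum_inter_add_sum_sdiff U S c
  have hS' := Finset.sum_inter_add_sum_sdiff S U (rank c)
  have hU' := Finset.sum_inter_add_sum_sdiff U S (rank c)
  rw [Finset.inter_comm] at hU hU'
  have hlt : ∑ a ∈ S \ U, c a < ∑ a ∈ U \ S, c a := by linarith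
  suffices ∑ a ∈ S \ U, rank c a < ∑ a ∈ U \ S, rank c a by
    unfold potential
    omega
  have h0 : 0 ≤ ∑ a ∈ S \ U, c a := Finset.sum_nonneg fun a _ => (hc a).le
  obtain ⟨b, hb⟩ : ∃ b, U \ S = {b} := by
    refine Finset.card_eq_one.1 (le_antisymm hUS (Finset.card_pos.2 ?_))
    refine Finset.nonempty_iff_ne_empty.2 fun h' => ?_
    rw [h', Finset.sum_empty] at hlt
    linarith
  rw [hb, Finset.sum_singleton] at hlt ⊢
  rcases (S \ U).eq_empty_or_nonempty with h' | h'
  · rw [h', Finset.sum_empty]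
    exact Nat.succ_pos _
  · obtain ⟨a, ha⟩ := Finset.card_eq_one.1 (le_antisymm hSU (Finset.card_pos.2 h'))
    rw [ha, Finset.sum_singleton] at hlt ⊢
    exact rank_lt_rank hlt

/-! ### Demanded sets and best responses -/

theorem agentUtility_eq_mul {α : ℝ} (hα : α ≠ 0) (S : Finset (Fin n)) :
    agentUtility f c α S = α * (f S - ∑ i ∈ S, c i / α) := by
  rw [agentUtility, mul_sub, Finset.mul_sum]
  congr 1
  exact Finset.sum_congr rfl fun i _ => by field_simp

theorem agentUtility_add (γ δ : ℝ) (S : Finset (Fin n)) :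
    agentUtility f c (γ + δ) S = agentUtility f c γ S + δ * f S := by
  unfold agentUtility
  ring

/-- A demanded set that is not a best response can be exchanged for a demanded set of larger
potential: a single improvement at a contract slightly above `γ` is still demanded at `γ`. -/
theorem exists_mem_demand_potential_lt (hf : IsSuccessProbability f)
    (hgs : IsGrossSubstitutes f) (hc : ∀ a, 0 < c a) {γ : ℝ} (hγ : 0 < γ) {S : Finset (Fin n)}
    (hS : S ∈ demand f c γ) (hS' : S ∉ bestResponses f c γ) :
    ∃ U ∈ demand f c γ, potential c S < potential c U := by
  obtain ⟨T, hT, hTS⟩ : ∃ T ∈ demand f c γ, f S < f T := by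
    by_contra! h
    exact hS' ⟨hS, h⟩
  obtain ⟨δ, hδ, hgap⟩ : ∃ δ > 0, ∀ U, agentUtility f c γ U < agentUtility f c γ S →
      agentUtility f c γ U + δ * f U < agentUtility f c γ S + δ * f S := by
    have h1 : ∀ᶠ δ in 𝓝 (0 : ℝ), ∀ U, agentUtility f c γ U < agentUtility f c γ S →
        agentUtility f c γ U + δ * f U < agentUtility f c γ S + δ * f S := by
      refine eventually_all.2 fun U => ?_
      by_cases h : agentUtility f c γ U < agentUtility f c γ S
      · have hcont : ∀ V, Tendsto (fun δ => agentUtility f c γ V + δ * f V) (𝓝 0)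
            (𝓝 (agentUtility f c γ V)) := fun V => by
          have : Continuous fun δ => agentUtility f c γ V + δ * f V := by fun_prop
          simpa using this.tendsto 0
        filter_upwards [(hcont U).eventually_lt (hcont S) h] with δ hδ _ using hδ
      · exact Eventually.of_forall fun δ h' => absurd h' h
    have h2 : ∀ᶠ δ in 𝓝[>] (0 : ℝ), 0 < δ := self_mem_nhdsWithin
    exact (h2.and (h1.filter_mono nhdsWithin_le_nhds)).exists
  have hγδ : 0 < γ + δ := by linarith
  have hlt_iff : ∀ U V : Finset (Fin n),
      f U - ∑ i ∈ U, c i / (γ + δ) < f V - ∑ i ∈ V, c i / (γ + δ) ↔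
        agentUtility f c γ U + δ * f U < agentUtility f c γ V + δ * f V := fun U V => by
    rw [← agentUtility_add, ← agentUtility_add, agentUtility_eq_mul hγδ.ne',
      agentUtility_eq_mul hγδ.ne', mul_lt_mul_iff_right₀ hγδ]
  have hnot : S ∉ priceDemand f fun i => c i / (γ + δ) := fun h => by
    refine (h T).not_gt ((hlt_iff S T).2 ?_)
    have := mul_lt_mul_of_pos_left hTS hδ
    linarith [hT S]
  obtain ⟨U, hSU, h1, h2⟩ :=
    hgs.exists_single_improvement hf (fun i => div_pos (hc i) hγδ) hnot
  rw [hlt_iff] at hSU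
  have hUS : agentUtility f c γ U = agentUtility f c γ S :=
    le_antisymm (hS U) (not_lt.1 fun h => (hgap U h).not_gt hSU)
  have hfU : f S < f U := by
    rw [hUS] at hSU
    exact lt_of_mul_lt_mul_left (by linarith) hδ.le
  refine ⟨U, fun V => hUS ▸ hS V, potential_lt_potential hc h1 h2 ?_⟩
  have := mul_lt_mul_of_pos_left hfU hγ
  unfold agentUtility at hUS
  linarith

/-- The largest potential of a set that is demanded under the contract `α`. -/
noncomputable def maxPotential (f : Finset (Fin n) → ℝ) (c : Fin n → ℝ) (α : ℝ) : ℕ :=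
  sSup (potential c '' demand f c α)

theorem bddAbove_potential (α : ℝ) : BddAbove (potential c '' demand f c α) :=
  ((Set.toFinite (demand f c α)).image _).bddAbove

theorem potential_le_maxPotential_of_mem {α : ℝ} {S : Finset (Fin n)} (hS : S ∈ demand f c α) :
    potential c S ≤ maxPotential f c α :=
  le_csSup (bddAbove_potential α) ⟨S, hS, rfl⟩

theorem exists_potential_eq_maxPotential (f : Finset (Fin n) → ℝ) (c : Fin n → ℝ) (α : ℝ) :
    ∃ S ∈ demand f c α, potential c S = maxPotential f c α := by
  obtain ⟨S, hS⟩ := bestResponses_nonempty f c α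
  exact Nat.sSup_mem (s := potential c '' demand f c α) ⟨_, S, hS.1, rfl⟩ (bddAbove_potential α)

theorem exists_mem_bestResponses_potential_eq (hf : IsSuccessProbability f)
    (hgs : IsGrossSubstitutes f) (hc : ∀ a, 0 < c a) {γ : ℝ} (hγ : 0 < γ) :
    ∃ S ∈ bestResponses f c γ, potential c S = maxPotential f c γ := by
  obtain ⟨S, hS, hmax⟩ := exists_potential_eq_maxPotential f c γ
  refine ⟨S, ?_, hmax⟩
  by_contra h
  obtain ⟨U, hU, hlt⟩ := exists_mem_demand_potential_lt hf hgs hc hγ hS h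
  exact (hmax ▸ hlt).not_ge (potential_le_maxPotential_of_mem hU)

theorem mem_demand_of_forall_lt {α β : ℝ} (hαβ : α ≤ β) {S : Finset (Fin n)}
    (hS : S ∈ demand f c α)
    (h : ∀ U, f S < f U → agentUtility f c β U ≤ agentUtility f c β S) :
    S ∈ demand f c β := by
  intro U
  rcases lt_or_ge (f S) (f U) with hU | hU
  · exact h U hU
  · have h1 := hS U
    have h2 := mul_le_mul_of_nonneg_left hU (sub_nonneg.2 hαβ)
    unfold agentUtility at h1 ⊢
    linarith

/-- A best response either remains one up to `β`, or there is a first contract at which it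
is demanded without being a best response. -/
theorem mem_bestResponses_or_exists {α β : ℝ} (hαβ : α ≤ β) {S : Finset (Fin n)}
    (hS : S ∈ bestResponses f c α) :
    S ∈ bestResponses f c β ∨
      ∃ γ, α < γ ∧ γ ≤ β ∧ S ∈ demand f c γ ∧ S ∉ bestResponses f c γ := by
  have hslope : ∀ U, f S < f U → ∀ γ, γ ≤ (∑ a ∈ U, c a - ∑ a ∈ S, c a) / (f U - f S) ↔
      agentUtility f c γ U ≤ agentUtility f c γ S := fun U hU γ => by
    rw [le_div_iff₀ (sub_pos.2 hU)]
    unfold agentUtility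
    constructor <;> intro h <;> linarith
  by_cases hne : ∃ U, f S < f U
  · obtain ⟨T, hT, hmin⟩ := Set.exists_min_image {U | f S < f U}
      (fun U => (∑ a ∈ U, c a - ∑ a ∈ S, c a) / (f U - f S)) (Set.toFinite _) hne
    have hT' : f S < f T := hT
    set γ := (∑ a ∈ T, c a - ∑ a ∈ S, c a) / (f T - f S) with hγ
    have hαγ : α < γ := by
      rw [hγ, lt_div_iff₀ (sub_pos.2 hT')]
      have hTα : T ∉ demand f c α := fun h => (hS.2 T h).not_gt hT'
      have hlt : agentUtility f c α T < agentUtility f c α S :=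
        not_le.1 fun h => hTα fun V => (hS.1 V).trans h
      unfold agentUtility at hlt
      linarith
    have hdem : ∀ δ, α ≤ δ → δ ≤ γ → S ∈ demand f c δ := fun δ h1 h2 =>
      mem_demand_of_forall_lt h1 hS.1 fun U hU => (hslope U hU δ).1 (h2.trans (hmin U hU))
    rcases le_or_gt γ β with h | h
    · have hSγ := hdem γ hαγ.le le_rfl
      refine Or.inr ⟨γ, hαγ, h, hSγ, fun hb => (hb.2 T fun V => (hSγ V).trans ?_).not_gt hT'⟩
      have := div_mul_cancel₀ (∑ a ∈ T, c a - ∑ a ∈ S, c a) (sub_pos.2 hT').ne'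
      rw [← hγ] at this
      unfold agentUtility
      linarith
    · refine Or.inl ⟨hdem β hαβ h.le, fun U hU => not_lt.1 fun hlt => ?_⟩
      have h1 : β < (∑ a ∈ U, c a - ∑ a ∈ S, c a) / (f U - f S) := h.trans_le (hmin U hlt)
      rw [lt_div_iff₀ (sub_pos.2 hlt)] at h1
      have h2 := hU S
      unfold agentUtility at h2
      linarith
  · push Not at hne
    exact Or.inl ⟨mem_demand_of_forall_lt hαβ hS.1 fun U hU => absurd hU (hne U).not_gt,
      fun U _ => hne U⟩

/-! ### Counting the critical values -/

theorem potential_le_maxPotential (hf : IsSuccessProbability f) (hgs : IsGrossSubstitutes f)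
    (hc : ∀ a, 0 < c a) {α β : ℝ} (hα : 0 ≤ α) (hαβ : α ≤ β) {S : Finset (Fin n)}
    (hS : S ∈ bestResponses f c α) :
    potential c S ≤ maxPotential f c β ∧
      (f S ≠ responseValue f c β → potential c S < maxPotential f c β) := by
  induction hk : n * (n + 1) / 2 - potential c S using Nat.strong_induction_on generalizing α S with
  | _ k ih =>
    rcases mem_bestResponses_or_exists hαβ hS with h | ⟨γ, hαγ, hγβ, hSγ, hSγ'⟩
    · exact ⟨potential_le_maxPotential_of_mem h.1, fun h' => absurd (responseValue_eq h).symm h'⟩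
    · have hγ : 0 < γ := hα.trans_lt hαγ
      obtain ⟨U, hU, hSU⟩ := exists_mem_demand_potential_lt hf hgs hc hγ hSγ hSγ'
      obtain ⟨T, hT, hmax⟩ := exists_mem_bestResponses_potential_eq hf hgs hc hγ
      have hST : potential c S < potential c T :=
        hmax ▸ hSU.trans_le (potential_le_maxPotential_of_mem hU)
      have hTN := potential_le c T
      have hTβ := (ih _ (by omega) hγ.le hγβ hT rfl).1
      exact ⟨hST.le.trans hTβ, fun _ => hST.trans_le hTβ⟩

theorem maxPotential_lt_of_mem_criticalSet (hf : IsSuccessProbability f)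
    (hgs : IsGrossSubstitutes f) (hc : ∀ a, 0 < c a) {α β : ℝ} (hα : 0 < α) (hαβ : α < β)
    (hβ : β ∈ criticalSet f c) : maxPotential f c α < maxPotential f c β := by
  obtain ⟨S, hS, hmax⟩ := exists_mem_bestResponses_potential_eq hf hgs hc hα
  have hne := hβ.2 (β - α) (sub_pos.2 hαβ) (by linarith)
  rw [sub_sub_cancel, responseValue_eq hS] at hne
  exact hmax ▸ (potential_le_maxPotential hf hgs hc hα.le hαβ.le hS).2 hne.symm

theorem maxPotential_pos_of_mem_criticalSet (hf : IsSuccessProbability f)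
    (hgs : IsGrossSubstitutes f) (hc : ∀ a, 0 < c a) {β : ℝ} (hβ : β ∈ criticalSet f c) :
    0 < maxPotential f c β := by
  obtain ⟨S, hS⟩ := bestResponses_nonempty f c 0
  have hne := hβ.2 β hβ.1.1 le_rfl
  rw [sub_self, responseValue_eq hS] at hne
  exact (Nat.zero_le _).trans_lt
    ((potential_le_maxPotential hf hgs hc le_rfl hβ.1.1.le hS).2 hne.symm)

end CombinatorialContracts

open CombinatorialContracts in
theorem mainTheorem2 (n : ℕ) (f : Finset (Fin n) → ℝ) (c : Fin n → ℝ)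
    (hf : CombinatorialContracts.IsSuccessProbability f)
    (hgs : CombinatorialContracts.IsGrossSubstitutes f)
    (hc : ∀ a, 0 < c a) :
    (CombinatorialContracts.criticalSet f c).Finite ∧
      (CombinatorialContracts.criticalSet f c).ncard ≤ n * (n + 1) / 2 := by
  have hmaps : Set.MapsTo (maxPotential f c) (criticalSet f c)
      (Finset.Icc 1 (n * (n + 1) / 2) : Finset ℕ) := fun β hβ => by
    obtain ⟨S, -, hS⟩ := exists_potential_eq_maxPotential f c β
    rw [Finset.mem_coe, Finset.mem_Icc]
    exact ⟨maxPotential_pos_of_mem_criticalSet hf hgs hc hβ, hS ▸ potential_le c S⟩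
  have hmono : StrictMonoOn (maxPotential f c) (criticalSet f c) := fun α hα β hβ hαβ =>
    maxPotential_lt_of_mem_criticalSet hf hgs hc hα.1.1 hαβ hβ
  refine ⟨Set.Finite.of_injOn hmaps hmono.injOn (Finset.finite_toSet _), ?_⟩
  have h := Set.ncard_le_ncard_of_injOn _ hmaps hmono.injOn (Finset.finite_toSet _)
  rwa [Set.ncard_coe_finset, Nat.card_Icc, Nat.add_sub_cancel] at h
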